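/- Assume the Continuum Hypothesis, $\aleph_1 = 2^{\aleph_0}$. Let $X$ be a Tychonoff (completely regular $T_0$, equivalently completely regular Hausdorff) space in which every one-point set $\{x\}$ is a $G_\delta$, that is, an intersection of countably many open sets. Let $\mathcal{O}$ be the family of all open coverings of $X$. The long Menger game $\mathsf{G}_{\mathrm{fin}}^{\omega_1}(\mathcal{O},\mathcal{O})$ is played in innings $\xi<\omega_1$: in inning $\xi$ player I chooses an open covering $\mathcal{C}_\xi\in\mathcal{O}$, and then player II chooses a finite subset $\mathcal{F}_\xi\subseteq\mathcal{C}_\xi$. Player II wins if $\bigcup_{\xi<\omega_1}\mathcal{F}_\xi$ is a covering of $X$. A strategy for player II is a function assigning to every sequence $(\mathcal{C}_\eta)_{\eta\le\xi}$ of open coverings with $\xi<\omega_1$ a finite subset of $\mathcal{C}_\xi$; it is winning if player II wins every play in which the sets $\mathcal F_\xi$ are chosen according to it. If player II has a winning strategy in the game $\mathsf{G}_{\mathrm{fin}}^{\omega_1}(\mathcal{O},\mathcal{O})$ on $X$, then $|X|\le 2^{\aleph_0}$. -/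

import Mathlib

open scoped Cardinal Ordinal

/-- The family `O` of all open coverings of `X`. -/
def openCovers (X : Type*) [TopologicalSpace X] : Set (Set (Set X)) :=
  {𝒰 | (∀ U ∈ 𝒰, IsOpen U) ∧ ⋃₀ 𝒰 = Set.univ}

/-- A strategy for player II in the selection game `G_fin^κ(𝒜, ·)` of length `κ`: in each inning
`α < κ` player I chooses `A_α ∈ 𝒜`, and player II, knowing `(A_β)_{β ≤ α}`, answers with a finite
subset of `A_α`. -/
structure GfinStrategy {S : Type*} (κ : Ordinal) (𝒜 : Set (Set S)) where
  /-- The answer of player II in inning `α` to the moves of player I up to and including `α`. -/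
  move : (α : Set.Iio κ) → (Set.Iic α → 𝒜) → Set S
  move_finite : ∀ α φ, (move α φ).Finite
  move_subset : ∀ α φ, move α φ ⊆ (φ ⟨α, Set.mem_Iic.2 le_rfl⟩ : Set S)

/-- The strategy wins `G_fin^κ(𝒜, ℬ)`: against every sequence of moves of player I, the union of
the finite sets chosen by player II belongs to `ℬ`. -/
def GfinStrategy.IsWinning {S : Type*} {κ : Ordinal} {𝒜 : Set (Set S)}
    (F : GfinStrategy κ 𝒜) (ℬ : Set (Set S)) : Prop :=
  ∀ φ : Set.Iio κ → 𝒜, (⋃ α : Set.Iio κ, F.move α (fun β => φ β)) ∈ ℬ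

/-- Player II has a winning strategy in `G_fin^κ(𝒜, ℬ)`. -/
def PlayerIIWinsGfin {S : Type*} (κ : Ordinal) (𝒜 ℬ : Set (Set S)) : Prop :=
  ∃ F : GfinStrategy κ 𝒜, F.IsWinning ℬ

/-!
Fix the moves `p` that player I made before some inning, and let `K` be the set of points that
lie in the closure of player II's reply to every open cover. Regularity makes `K` compact, so
`K` has at most `𝔠` points by Arhangel'skii's theorem. Constant plays of player I show that every
open cover has a subcover of size at most `𝔠`; the complement of a compact set inherits this, so
`𝔠` many covers, the menu at `p`, suffice to keep every point outside `K` away from the reply.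
If `y` avoided `K` at every position reached by choosing from the menus, player I could keep `y`
uncovered throughout. So `X` is the union of the sets `K` over these positions, and there are at
most `𝔠` of them because `2 ^ |α| ≤ 𝔠` for every inning `α`.
-/

open Set Filter Topology

section Cardinality

universe v

theorem mk_iUnion_le_continuum {α ι : Type*} {f : ι → Set α} (hι : #ι ≤ 𝔠)
    (hf : ∀ i, #(f i) ≤ 𝔠) : #(⋃ i, f i) ≤ 𝔠 := by
  rw [← Cardinal.lift_le_continuum]
  calc
    _ ≤ _ := Cardinal.mk_iUnion_le_lift f
    _ ≤ 𝔠 * 𝔠 := mul_le_mul' (Cardinal.lift_le_continuum.2 hι)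
      (ciSup_le' fun i ↦ Cardinal.lift_le_continuum.2 (hf i))
    _ = 𝔠 := Cardinal.continuum_mul_self

theorem mk_range_le_continuum {α ι : Type*} (f : ι → α) (hι : #ι ≤ 𝔠) : #(range f) ≤ 𝔠 :=
  Cardinal.lift_le_continuum.1 <|
    Cardinal.mk_range_le_lift.trans (Cardinal.lift_le_continuum.2 hι)

theorem mk_finset_le_continuum {α : Type*} (hα : #α ≤ 𝔠) : #(Finset α) ≤ 𝔠 := by
  classical
  calc
    #(Finset α) ≤ #(List α) := Cardinal.mk_le_of_surjective List.toFinset_surjective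
    _ ≤ max ℵ₀ #α := Cardinal.mk_list_le_max α
    _ ≤ 𝔠 := max_le Cardinal.aleph0_le_continuum hα

theorem continuum_power_le_continuum {c : Cardinal} (hc : 2 ^ c ≤ 𝔠) : 𝔠 ^ c ≤ 𝔠 :=
  calc
    𝔠 ^ c = (2 ^ c) ^ ℵ₀ := by
      rw [← Cardinal.two_power_aleph0, ← Cardinal.power_mul, mul_comm, Cardinal.power_mul]
    _ ≤ 𝔠 ^ ℵ₀ := Cardinal.power_le_power_right hc
    _ = 𝔠 := Cardinal.continuum_power_aleph0

theorem exists_injOn_of_mk_le_continuum {α : Type*} {s : Set α} (hs : #s ≤ 𝔠) :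
    ∃ f : α → Set ℕ, InjOn f s := by
  have hlift : Cardinal.lift.{0} #s ≤ Cardinal.lift #(Set ℕ) := by simpa using hs
  obtain ⟨g⟩ := Cardinal.lift_mk_le'.1 hlift
  refine ⟨Function.extend (↑) g fun _ ↦ ∅, injOn_iff_injective.2 ?_⟩
  convert g.injective
  exact funext fun x ↦ Subtype.val_injective.extend_apply g _ x

theorem exists_closed_under_countable_operations {Y A : Type*} (hA : #A ≤ 𝔠)
    (op : A → (ℕ → Y) → Y) {S : Set Y} (hS : #S ≤ 𝔠) :
    ∃ H, S ⊆ H ∧ #H ≤ 𝔠 ∧ ∀ a x, (∀ n, x n ∈ H) → op a x ∈ H := by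
  -- `H` is the set of values of the well-founded terms with constants `S` and operations `A`.
  let arity : S ⊕ A → Type := Sum.elim (fun _ ↦ Empty) fun _ ↦ ℕ
  let value : (Σ c, arity c → Y) → Y
    | ⟨.inl y, _⟩ => y
    | ⟨.inr a, x⟩ => op a x
  have hterm : ∀ c, 𝔠 ^ Cardinal.lift #(arity c) ≤ 𝔠 := by
    rintro (y | a)
    · simpa [arity] using Cardinal.one_le_aleph0.trans Cardinal.aleph0_le_continuum
    · simp [arity]
  have hterms : #(WType arity) ≤ 𝔠 := by
    refine WType.cardinalMk_le_of_le' ((Cardinal.sum_le_sum _ (fun _ ↦ 𝔠) hterm).trans ?_)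
    have hSA : #(S ⊕ A) ≤ 𝔠 := by
      rw [Cardinal.mk_sum, ← Cardinal.continuum_add_self]
      exact add_le_add (Cardinal.lift_le_continuum.2 hS) (Cardinal.lift_le_continuum.2 hA)
    rw [Cardinal.sum_const, Cardinal.lift_continuum]
    exact (mul_le_mul_left (Cardinal.lift_le_continuum.2 hSA) _).trans_eq
      Cardinal.continuum_mul_self
  refine ⟨range (WType.elim Y value), fun y hy ↦ ⟨.mk (.inl ⟨y, hy⟩) Empty.elim, rfl⟩,
    mk_range_le_continuum _ hterms, fun a x hx ↦ ?_⟩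
  choose w hw using hx
  exact ⟨.mk (.inr a) w, congrArg (op a) (funext hw)⟩

theorem mk_Iio_le_continuum_of_two_power_card_le {κ : Ordinal}
    (hκ : ∀ α < κ, 2 ^ α.card ≤ 𝔠) : #(Iio κ) ≤ 𝔠 := by
  have hord : κ ≤ Cardinal.ord 𝔠 := not_lt.1 fun h ↦
    (Cardinal.cantor 𝔠).not_ge (by simpa using hκ _ h)
  rw [Cardinal.mk_Iio_ordinal, Cardinal.lift_le_continuum]
  exact (Ordinal.card_le_card hord).trans_eq (Cardinal.card_ord 𝔠)

theorem mk_Iio_coe_ordinal {κ : Ordinal.{v}} (α : Iio κ) :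
    #(Iio α) = Cardinal.lift.{v + 1} α.1.card := by
  have himage : Subtype.val '' Iio α = Iio α.1 := by
    ext β
    simp
  rw [← Cardinal.mk_Iio_ordinal, ← himage, Cardinal.mk_image_eq Subtype.val_injective]

theorem two_power_card_le_continuum_of_lt_omega_one {α : Ordinal} (hα : α < ω₁) :
    2 ^ α.card ≤ 𝔠 := by
  have hcard : α.card ≤ ℵ₀ := by
    rwa [Cardinal.lt_omega_iff_card_lt, ← Cardinal.succ_aleph0, Order.lt_succ_iff] at hα
  exact Cardinal.two_power_aleph0 ▸ Cardinal.power_le_power_left two_ne_zero hcard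

end Cardinality

section Arhangelskii

variable {Y : Type*} [TopologicalSpace Y]

theorem exists_seq_nhds_cover_of_notMem [T1Space Y] {U : Y → ℕ → Set Y}
    (hU : ∀ y, (𝓝 y).HasBasis (fun _ ↦ True) (U y)) {H : Set Y} (hH : IsLindelof H)
    (hne : H.Nonempty) {y : Y} (hy : y ∉ H) :
    ∃ (x : ℕ → Y) (m : ℕ → ℕ), (∀ i, x i ∈ H) ∧ H ⊆ ⋃ i, U (x i) (m i) ∧
      y ∉ ⋃ i, U (x i) (m i) := by
  have hsep : ∀ x ∈ H, ∃ n, y ∉ U x n := fun x hx ↦ by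
    have hxy : x ≠ y := fun h ↦ hy (h ▸ hx)
    obtain ⟨n, -, hn⟩ := (hU x).mem_iff.1 (isOpen_compl_singleton.mem_nhds hxy)
    exact ⟨n, fun hyn ↦ hn hyn rfl⟩
  choose! n hn using hsep
  obtain ⟨t, htc, htH, hcover⟩ := hH.elim_nhds_subcover (fun x ↦ U x (n x))
    fun x _ ↦ (hU x).mem_of_mem trivial
  have htne : t.Nonempty := by
    obtain ⟨z, hz⟩ := hne
    obtain ⟨x, hx, -⟩ := mem_iUnion₂.1 (hcover hz)
    exact ⟨x, hx⟩
  obtain ⟨x, rfl⟩ := htc.exists_eq_range htne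
  rw [forall_mem_range] at htH
  rw [biUnion_range] at hcover
  exact ⟨x, n ∘ x, htH, hcover, by simpa using fun i ↦ hn _ (htH i)⟩

/-- **Arhangel'skii's theorem** for first countable spaces. -/
theorem mk_le_continuum_of_lindelofSpace [LindelofSpace Y] [T2Space Y]
    [FirstCountableTopology Y] : #Y ≤ 𝔠 := by
  rcases isEmpty_or_nonempty Y with _ | ⟨⟨y₀⟩⟩
  · simp
  have : Nonempty Y := ⟨y₀⟩
  choose U hU using fun y : Y ↦ (𝓝 y).exists_antitone_basis
  -- `H` will be closed under limits of sequences and under choosing, for every countable union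
  -- of basic neighbourhoods of points of `H`, a point outside it whenever there is one.
  let op : Option (ℕ → ℕ) → (ℕ → Y) → Y
    | none, x => limUnder atTop x
    | some m, x => Classical.epsilon fun z ↦ z ∉ ⋃ i, U (x i) (m i)
  have hops : #(Option (ℕ → ℕ)) ≤ 𝔠 := by simpa using (Cardinal.continuum_add_nat 1).le
  obtain ⟨H, hy₀, hHc, hop⟩ :=
    exists_closed_under_countable_operations hops op (S := {y₀})
      (Cardinal.mk_le_aleph0.trans Cardinal.aleph0_le_continuum)
  have hclosed : IsClosed H :=
    IsSeqClosed.isClosed fun x y hx hxy ↦ hxy.limUnder_eq ▸ hop none x hx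
  suffices H = univ by rwa [this, Cardinal.mk_univ] at hHc
  refine eq_univ_of_forall fun y ↦ by_contra fun hy ↦ ?_
  obtain ⟨x, m, hx, hcover, hym⟩ := exists_seq_nhds_cover_of_notMem
    (fun y ↦ (hU y).toHasBasis) hclosed.isLindelof ⟨y₀, hy₀ rfl⟩ hy
  exact Classical.epsilon_spec (p := fun z ↦ z ∉ ⋃ i, U (x i) (m i)) ⟨y, hym⟩
    (hcover (hop (some m) x hx))

theorem isCountablyGenerated_nhds_of_isGδ_singleton [CompactSpace Y] [RegularSpace Y] {y : Y}
    (hy : IsGδ {y}) : (𝓝 y).IsCountablyGenerated := by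
  obtain ⟨U, hUo, hU⟩ := hy.eq_iInter_nat
  have hyU : ∀ n, y ∈ U n := mem_iInter.1 (hU ▸ mem_singleton y)
  choose V hV hVc hVU using fun n ↦
    exists_mem_nhds_isClosed_subset ((hUo n).mem_nhds (hyU n))
  suffices 𝓝 y = ⨅ n, 𝓟 (V n) by rw [this]; infer_instance
  refine le_antisymm (le_iInf fun n ↦ le_principal_iff.2 (hV n))
    (le_nhds_of_unique_clusterPt fun x hx ↦ ?_)
  have hxU : x ∈ ⋂ n, U n := mem_iInter.2 fun n ↦ hVU n <| (hVc n).closure_eq ▸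
    mem_closure_iff_clusterPt.2 (hx.mono (iInf_le _ n))
  rwa [← hU] at hxU

theorem mk_le_continuum_of_isCompact [T2Space Y] (hGδ : ∀ y : Y, IsGδ {y}) {K : Set Y}
    (hK : IsCompact K) : #K ≤ 𝔠 := by
  have : CompactSpace K := isCompact_iff_compactSpace.1 hK
  have : FirstCountableTopology K := ⟨fun y ↦ by
    have hy := (hGδ y).preimage (continuous_subtype_val (p := (· ∈ K)))
    rw [← image_singleton, preimage_image_eq _ Subtype.val_injective] at hy
    exact isCountablyGenerated_nhds_of_isGδ_singleton hy⟩
  exact mk_le_continuum_of_lindelofSpace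

theorem exists_compl_eq_sUnion_isClosed_of_isCompact [T2Space Y] (hGδ : ∀ y : Y, IsGδ {y})
    {K : Set Y} (hK : IsCompact K) :
    ∃ 𝒟 : Set (Set Y), #𝒟 ≤ 𝔠 ∧ (∀ D ∈ 𝒟, IsClosed D) ∧ Kᶜ = ⋃₀ 𝒟 := by
  classical
  choose U hUo hU using fun y ↦ (hGδ y).eq_iInter_nat
  let W : Finset (K × ℕ) → Set Y := fun t ↦ ⋃ q ∈ t, U q.1 q.2
  have hcard : #(K × ℕ) ≤ 𝔠 := by
    simpa using mul_le_mul' (mk_le_continuum_of_isCompact hGδ hK) Cardinal.aleph0_le_continuum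
  refine ⟨range fun t : {t // K ⊆ W t} ↦ (W t)ᶜ,
    mk_range_le_continuum _ ((Cardinal.mk_subtype_le _).trans (mk_finset_le_continuum hcard)),
    forall_mem_range.2 fun t ↦ (isOpen_biUnion fun q _ ↦ hUo _ _).isClosed_compl,
    Subset.antisymm (fun y hy ↦ ?_)
      (sUnion_subset <| forall_mem_range.2 fun t ↦ compl_subset_compl.2 t.2)⟩
  have hsep : ∀ x : K, ∃ n, y ∉ U x n := fun x ↦ by
    have hyx : y ∉ ⋂ n, U x n := hU x ▸ fun h ↦ hy (h ▸ x.2)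
    simpa using hyx
  choose n hn using hsep
  have hmem : ∀ x m, x ∈ U x m := fun x ↦ mem_iInter.1 (hU x ▸ mem_singleton x)
  obtain ⟨t, ht⟩ := hK.elim_finite_subcover (fun x : K ↦ U x (n x)) (fun x ↦ hUo _ _)
    fun x hx ↦ mem_iUnion.2 ⟨⟨x, hx⟩, hmem _ _⟩
  have hW : W (t.image fun x ↦ (x, n x)) = ⋃ x ∈ t, U x (n x) := Finset.set_biUnion_finset_image
  refine ⟨_, ⟨⟨_, ht.trans hW.ge⟩, rfl⟩, ?_⟩
  simpa [hW] using fun x hx _ ↦ hn ⟨x, hx⟩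

end Arhangelskii

section ContinuumLindelof

variable {X : Type*} [TopologicalSpace X]

/-- A set is *continuum-Lindelöf* if each of its open covers has a subcover of size at most `𝔠`,
that is, if its Lindelöf degree is at most `𝔠`. -/
def IsContinuumLindelof (s : Set X) : Prop :=
  ∀ 𝒰 : Set (Set X), (∀ U ∈ 𝒰, IsOpen U) → s ⊆ ⋃₀ 𝒰 → ∃ 𝒱 ⊆ 𝒰, #𝒱 ≤ 𝔠 ∧ s ⊆ ⋃₀ 𝒱

namespace IsContinuumLindelof

theorem elim_subcover {s : Set X} (hs : IsContinuumLindelof s) {ι : Type*} {U : ι → Set X}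
    (hUo : ∀ i, IsOpen (U i)) (hsU : s ⊆ ⋃ i, U i) :
    ∃ t : Set ι, #t ≤ 𝔠 ∧ s ⊆ ⋃ i ∈ t, U i := by
  obtain ⟨𝒱, h𝒱U, h𝒱c, hs𝒱⟩ := hs (range U) (forall_mem_range.2 hUo) (by rwa [sUnion_range])
  choose i hi using fun V : 𝒱 ↦ h𝒱U V.2
  refine ⟨range i, mk_range_le_continuum i h𝒱c, ?_⟩
  rwa [biUnion_range, iUnion_congr hi, ← sUnion_eq_iUnion]

theorem inter_right {s t : Set X} (hs : IsContinuumLindelof s) (ht : IsClosed t) :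
    IsContinuumLindelof (s ∩ t) := by
  intro 𝒰 h𝒰o h𝒰
  obtain ⟨𝒱, h𝒱𝒰, h𝒱c, hs𝒱⟩ := hs (insert tᶜ 𝒰)
    (forall_mem_insert.2 ⟨ht.isOpen_compl, h𝒰o⟩) (by
      rw [sUnion_insert]
      exact fun x hx ↦ or_iff_not_imp_left.2 fun hxt ↦ h𝒰 ⟨hx, not_not.1 hxt⟩)
  refine ⟨𝒱 ∩ 𝒰, inter_subset_right,
    (Cardinal.mk_le_mk_of_subset inter_subset_left).trans h𝒱c, fun x ⟨hxs, hxt⟩ ↦ ?_⟩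
  obtain ⟨V, hV, hxV⟩ := hs𝒱 hxs
  exact ⟨V, ⟨hV, (h𝒱𝒰 hV).resolve_left fun h ↦ (h ▸ hxV) hxt⟩, hxV⟩

theorem sUnion {𝒮 : Set (Set X)} (h𝒮c : #𝒮 ≤ 𝔠) (h𝒮 : ∀ s ∈ 𝒮, IsContinuumLindelof s) :
    IsContinuumLindelof (⋃₀ 𝒮) := by
  intro 𝒰 h𝒰o h𝒰
  choose 𝒱 h𝒱𝒰 h𝒱c hs𝒱 using fun s : 𝒮 ↦
    h𝒮 s s.2 𝒰 h𝒰o ((subset_sUnion_of_mem s.2).trans h𝒰)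
  refine ⟨⋃ s, 𝒱 s, iUnion_subset h𝒱𝒰, mk_iUnion_le_continuum h𝒮c h𝒱c,
    sUnion_subset fun s hs ↦ (hs𝒱 ⟨s, hs⟩).trans ?_⟩
  exact sUnion_subset_sUnion (subset_iUnion 𝒱 ⟨s, hs⟩)

theorem compl_of_isCompact [T2Space X] (hGδ : ∀ x : X, IsGδ {x})
    (hX : IsContinuumLindelof (univ : Set X)) {K : Set X} (hK : IsCompact K) :
    IsContinuumLindelof Kᶜ := by
  obtain ⟨𝒟, h𝒟c, h𝒟, hK𝒟⟩ := exists_compl_eq_sUnion_isClosed_of_isCompact hGδ hK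
  rw [hK𝒟]
  exact sUnion h𝒟c fun D hD ↦ univ_inter D ▸ hX.inter_right (h𝒟 D hD)

end IsContinuumLindelof

end ContinuumLindelof

section SelectionKernel

variable {X : Type*} [TopologicalSpace X]

/-- The *kernel* of a selection `r` of a subfamily from every open cover: the points that no open
cover keeps away from the closure of the selected part. -/
def selectionKernel (r : openCovers X → Set (Set X)) : Set X :=
  ⋂ 𝒞, closure (⋃₀ r 𝒞)

variable {r : openCovers X → Set (Set X)}

theorem isCompact_selectionKernel [RegularSpace X] (hfin : ∀ 𝒞, (r 𝒞).Finite)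
    (hsub : ∀ 𝒞, r 𝒞 ⊆ 𝒞) : IsCompact (selectionKernel r) := by
  have hclosed : IsClosed (selectionKernel r) := isClosed_iInter fun _ ↦ isClosed_closure
  refine isCompact_iff_ultrafilter_le_nhds'.2 fun f hf ↦ ?_
  suffices ∃ x, (f : Filter X) ≤ 𝓝 x by
    obtain ⟨x, hx⟩ := this
    exact ⟨x, isClosed_iff_ultrafilter.1 hclosed x f hx hf, hx⟩
  by_contra! hlim
  let 𝒞 : Set (Set X) := {V | IsOpen V ∧ closure V ∉ f}
  have h𝒞 : 𝒞 ∈ openCovers X := by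
    refine ⟨fun V hV ↦ hV.1, eq_univ_of_forall fun x ↦ ?_⟩
    obtain ⟨N, hN, hNf⟩ := Filter.not_le.1 (hlim x)
    obtain ⟨V, ⟨hxV, hVo⟩, hVN⟩ := (nhds_basis_opens x).nhds_closure.mem_iff.1 hN
    exact ⟨V, ⟨hVo, fun h ↦ hNf (mem_of_superset h hVN)⟩, hxV⟩
  have hmem : closure (⋃₀ r ⟨𝒞, h𝒞⟩) ∈ f := mem_of_superset hf (iInter_subset _ _)
  rw [sUnion_eq_biUnion, (hfin _).closure_biUnion,
    Ultrafilter.finite_biUnion_mem_iff (hfin _)] at hmem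
  obtain ⟨V, hV, hVf⟩ := hmem
  exact (hsub _ hV).2 hVf

theorem exists_menu_of_selectionKernel [T3Space X] (hGδ : ∀ x : X, IsGδ {x})
    (hX : IsContinuumLindelof (univ : Set X)) (hfin : ∀ 𝒞, (r 𝒞).Finite)
    (hsub : ∀ 𝒞, r 𝒞 ⊆ 𝒞) :
    ∃ M : Set (openCovers X), #M ≤ 𝔠 ∧ ∀ y ∉ selectionKernel r, ∃ 𝒞 ∈ M, y ∉ ⋃₀ r 𝒞 := by
  have hK := hX.compl_of_isCompact hGδ (isCompact_selectionKernel hfin hsub)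
  obtain ⟨M, hMc, hM⟩ := hK.elim_subcover (U := fun 𝒞 ↦ (closure (⋃₀ r 𝒞))ᶜ)
    (fun 𝒞 ↦ isClosed_closure.isOpen_compl) (compl_iInter _).subset
  refine ⟨M, hMc, fun y hy ↦ ?_⟩
  obtain ⟨𝒞, h𝒞, hy𝒞⟩ := mem_iUnion₂.1 (hM hy)
  exact ⟨𝒞, h𝒞, fun h ↦ hy𝒞 (subset_closure h)⟩

end SelectionKernel

section Positions

variable {I A : Type*} [LinearOrder I]

theorem exists_play_eq [WellFoundedLT I] (c : (α : I) → (Iio α → A) → A) :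
    ∃ φ : I → A, ∀ α, φ α = c α fun β ↦ φ β :=
  ⟨wellFounded_lt.fix fun α p ↦ c α fun β ↦ p β β.2, wellFounded_lt.fix_eq _⟩

/-- The positions before inning `α`, recorded as the sequence of earlier moves of player I, in
which every move was chosen from the menu `M` of the position in which it was made. -/
def menuPositions (M : (α : I) → (Iio α → A) → Set A) (α : I) : Set (Iio α → A) :=
  {p | ∀ β : Iio α, p β ∈ M β fun γ : Iio β.1 ↦ p ⟨γ, γ.2.trans β.2⟩}

theorem mk_menuPositions_le_continuum [WellFoundedLT I] {M : (α : I) → (Iio α → A) → Set A}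
    (hM : ∀ α p, #(M α p) ≤ 𝔠) {α : I} (hα : 𝔠 ^ #(Iio α) ≤ 𝔠) :
    #(menuPositions M α) ≤ 𝔠 := by
  choose code hcode using fun β p ↦ exists_injOn_of_mk_le_continuum (hM β p)
  let codes : menuPositions M α → Iio α → Set ℕ :=
    fun p β ↦ code β (fun γ : Iio β.1 ↦ p.1 ⟨γ, γ.2.trans β.2⟩) (p.1 β)
  have hinj : Function.Injective codes := by
    rintro ⟨p, hp⟩ ⟨q, hq⟩ hpq
    refine Subtype.ext (funext fun β ↦ ?_)
    induction β using WellFoundedLT.induction with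
    | ind β ih =>
      have hβ : (fun γ : Iio β.1 ↦ p ⟨γ, γ.2.trans β.2⟩) = fun γ : Iio β.1 ↦ q ⟨γ, γ.2.trans β.2⟩ :=
        funext fun γ ↦ ih ⟨γ, γ.2.trans β.2⟩ γ.2
      have hcodes := congrFun hpq β
      simp only [codes, hβ] at hcodes
      exact hcode _ _ (hβ ▸ hp β) (hq β) hcodes
  rw [← Cardinal.lift_le_continuum]
  refine (Cardinal.lift_mk_le_lift_mk_of_injective hinj).trans (Cardinal.lift_le_continuum.2 ?_)
  simpa using hα

end Positions

namespace GfinStrategy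

variable {S : Type*} {κ : Ordinal} {𝒜 : Set (Set S)}

/-- Player II's answer in inning `α` to the move `A` of player I, made after the moves `p`. -/
noncomputable def reply (F : GfinStrategy κ 𝒜) (α : Iio κ) (p : Iio α → 𝒜) (A : 𝒜) : Set S :=
  F.move α fun β ↦ if h : β.1 < α then p ⟨β, h⟩ else A

variable (F : GfinStrategy κ 𝒜) (α : Iio κ)

theorem reply_finite (p : Iio α → 𝒜) (A : 𝒜) : (F.reply α p A).Finite :=
  F.move_finite _ _

theorem reply_subset (p : Iio α → 𝒜) (A : 𝒜) : F.reply α p A ⊆ A :=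
  (F.move_subset _ _).trans (by simp)

theorem reply_play (φ : Iio κ → 𝒜) : F.reply α (fun β ↦ φ β) (φ α) = F.move α fun β ↦ φ β := by
  refine congrArg (F.move α) (funext fun β ↦ ?_)
  rcases lt_or_eq_of_le (mem_Iic.1 β.2) with h | h <;> simp [h]

theorem IsWinning.exists_mem_selectionKernel {X : Type*} [TopologicalSpace X]
    {F : GfinStrategy κ (openCovers X)} (hF : F.IsWinning (openCovers X))
    {M : (α : Iio κ) → (Iio α → openCovers X) → Set (openCovers X)}
    (hM : ∀ α p, ∀ y ∉ selectionKernel (F.reply α p), ∃ 𝒞 ∈ M α p, y ∉ ⋃₀ F.reply α p 𝒞)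
    (y : X) : ∃ α, ∃ p ∈ menuPositions M α, y ∈ selectionKernel (F.reply α p) := by
  by_contra! hy
  have : Nonempty (openCovers X) := ⟨⟨{univ}, by simp [openCovers]⟩⟩
  choose! c hcM hyc using fun α p ↦ hM α p y
  obtain ⟨φ, hφ⟩ := exists_play_eq c
  have hyK : ∀ α, y ∉ selectionKernel (F.reply α fun β ↦ φ β) := fun α ↦ by
    induction α using WellFoundedLT.induction with
    | ind α ih => exact hy α _ fun β ↦ hφ β ▸ hcM _ _ (ih β β.2)
  obtain ⟨V, hV, hyV⟩ : y ∈ ⋃₀ ⋃ α, F.move α fun β ↦ φ β := (hF φ).2 ▸ mem_univ y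
  obtain ⟨α, hα⟩ := mem_iUnion.1 hV
  refine hyc α _ (hyK α) ⟨V, ?_, hyV⟩
  rwa [← hφ, reply_play]

end GfinStrategy

theorem PlayerIIWinsGfin.isContinuumLindelof_univ {κ : Ordinal} (hκ : #(Iio κ) ≤ 𝔠) {X : Type*}
    [TopologicalSpace X] (hII : PlayerIIWinsGfin κ (openCovers X) (openCovers X)) :
    IsContinuumLindelof (univ : Set X) := by
  obtain ⟨F, hF⟩ := hII
  intro 𝒰 h𝒰o h𝒰
  let φ : Iio κ → openCovers X := fun _ ↦ ⟨𝒰, h𝒰o, univ_subset_iff.1 h𝒰⟩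
  refine ⟨⋃ α, F.move α fun β ↦ φ β, iUnion_subset fun α ↦ F.move_subset α _,
    mk_iUnion_le_continuum hκ fun α ↦ ?_, (hF φ).2.ge⟩
  exact (F.move_finite α _).countable.le_aleph0.trans Cardinal.aleph0_le_continuum

theorem corollary2p12_general {κ : Ordinal} (hκ : ∀ α < κ, 2 ^ α.card ≤ 𝔠)
    {X : Type*} [TopologicalSpace X] [T3Space X] (hGδ : ∀ x : X, IsGδ ({x} : Set X))
    (hII : PlayerIIWinsGfin κ (openCovers X) (openCovers X)) : #X ≤ 𝔠 := by
  have hinnings : #(Iio κ) ≤ 𝔠 := mk_Iio_le_continuum_of_two_power_card_le hκ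
  have hX : IsContinuumLindelof (univ : Set X) := hII.isContinuumLindelof_univ hinnings
  obtain ⟨F, hF⟩ := hII
  choose M hMc hM using fun α p ↦
    exists_menu_of_selectionKernel hGδ hX (F.reply_finite α p) (F.reply_subset α p)
  have hpositions : ∀ α, #(menuPositions M α) ≤ 𝔠 := fun α ↦
    mk_menuPositions_le_continuum hMc <| continuum_power_le_continuum <| by
      simpa [mk_Iio_coe_ordinal] using Cardinal.lift_le_continuum.2 (hκ α α.2)
  have hkernel : ∀ α p, #(selectionKernel (F.reply α p)) ≤ 𝔠 := fun α p ↦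
    mk_le_continuum_of_isCompact hGδ
      (isCompact_selectionKernel (F.reply_finite α p) (F.reply_subset α p))
  have hcover : ⋃ α, ⋃ p : menuPositions M α, selectionKernel (F.reply α p) = univ :=
    eq_univ_of_forall fun y ↦ by
      obtain ⟨α, p, hp, hy⟩ := hF.exists_mem_selectionKernel hM y
      exact mem_iUnion₂.2 ⟨α, ⟨p, hp⟩, hy⟩
  rw [← Cardinal.mk_univ, ← hcover]
  exact mk_iUnion_le_continuum hinnings fun α ↦
    mk_iUnion_le_continuum (hpositions α) fun p ↦ hkernel α p

theorem corollary2p12 (CH : (ℵ₁ : Cardinal.{0}) = 2 ^ (ℵ₀ : Cardinal.{0}))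
    {X : Type*} [TopologicalSpace X] [T35Space X]
    (hGδ : ∀ x : X, IsGδ ({x} : Set X))
    (hII : PlayerIIWinsGfin (ω₁ : Ordinal.{0}) (openCovers X) (openCovers X)) :
    Cardinal.mk X ≤ 2 ^ ℵ₀ := by
  rw [Cardinal.two_power_aleph0]
  exact corollary2p12_general (fun _ ↦ two_power_card_le_continuum_of_lt_omega_one) hGδ hII
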